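/- Let $r\ge 3$ be an odd integer, let $q$ be a prime power with $q\equiv 1 \pmod{r+1}$, let $m\ge 1$ be an integer, and let $\mathbb{F}_{q^m}$ be the finite field with $q^m$ elements. Let $t$ be transcendental over $\mathbb{F}_{q^m}$, and let $\mathbb{F}_{q^m}(t,x)$ be the extension of the rational function field $\mathbb{F}_{q^m}(t)$ generated by a root $x$ of $$\mathcal{P}_t(T)=T^{r+1}+2T^{\frac{r+1}{2}}-T^3+T^2(t^{r+1}+1)-Tt^{r+1}+1\in\mathbb{F}_{q^m}(t)[T].$$ For a place $P$ of $\mathbb{F}_{q^m}(t,x)$ lying over the place $(t=\infty)$ of $\mathbb{F}_{q^m}(t)$, let $e(P|(t=\infty))$ denote its ramification index and $f(P|(t=\infty))$ its relative degree. Then: (1) If $-1$ is a square in $\mathbb{F}_{q^m}$, there are exactly four places of $\mathbb{F}_{q^m}(t,x)$ lying over $(t=\infty)$: two places $P_1,P_2$ with $e(P_i|(t=\infty))=1$ and $f(P_i|(t=\infty))=1$ for $i=1,2$, and two places $P_3,P_4$ with $e(P_i|(t=\infty))=\frac{r-1}{2}$ and $f(P_i|(t=\infty))=1$ for $i=3,4$.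 (2) If $-1$ is not a square in $\mathbb{F}_{q^m}$, there are exactly three places of $\mathbb{F}_{q^m}(t,x)$ lying over $(t=\infty)$: two places $P_1,P_2$ with $e(P_i|(t=\infty))=1$ and $f(P_i|(t=\infty))=1$ for $i=1,2$, and one place $P_3$ with $e(P_3|(t=\infty))=\frac{r-1}{2}$ and $f(P_3|(t=\infty))=2$. -/

import Mathlib

noncomputable section

open Polynomial

/-- A place of a field extension `F / K`, given by its valuation ring: a ring `O` with
`K ⊊ O ⊊ F` such that `z ∈ O` or `z⁻¹ ∈ O` for every `z ∈ F`. The place itself, as an ideal, is the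
maximal ideal of `O`. -/
@[ext]
structure Place (K F : Type*) [Field K] [Field F] [Algebra K F] where
  valuationRing : ValuationSubring F
  const_lt : (algebraMap K F).range < valuationRing.toSubring
  lt_top : valuationRing < ⊤

namespace Place

variable {K E F : Type*} [Field K] [Field E] [Field F] [Algebra K E] [Algebra K F] [Algebra E F]

/-- The maximal ideal of the valuation ring of a place. -/
def ideal (P : Place K F) : Ideal P.valuationRing :=
  IsLocalRing.maximalIdeal P.valuationRing

/-- `P` lies over `Q`: the valuation ring of `Q` is the intersection of the valuation ring of `P`
with the smaller field. -/
def LiesOver (P : Place K F) (Q : Place K E) : Prop :=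
  P.valuationRing.comap (algebraMap E F) = Q.valuationRing

/-- The type of the places of `F / K` lying over the place `Q` of `E / K`. -/
def Over (Q : Place K E) (F : Type*) [Field F] [Algebra K F] [Algebra E F] : Type _ :=
  {P : Place K F // P.LiesOver Q}

variable {Q : Place K E}

theorem Over.algebraMap_mem (P : Q.Over F) (z : Q.valuationRing) :
    algebraMap E F z ∈ P.1.valuationRing := by
  have h : (z : E) ∈ P.1.valuationRing.comap (algebraMap E F) := by
    rw [show P.1.valuationRing.comap (algebraMap E F) = Q.valuationRing from P.2]
    exact z.2
  exact h

/-- The inclusion of the valuation ring of `Q` in the valuation ring of a place over `Q`. -/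
def Over.inclusion (P : Q.Over F) : Q.valuationRing →+* P.1.valuationRing :=
  ((algebraMap E F).comp Q.valuationRing.subtype).codRestrict P.1.valuationRing.toSubring
    P.algebraMap_mem

/-- The ramification index `e(P | Q)`. -/
def Over.e (P : Q.Over F) : ℕ :=
  letI := P.inclusion.toAlgebra
  Ideal.ramificationIdx' Q.ideal P.1.ideal

/-- The relative degree `f(P | Q)`: the degree of the extension of residue fields. -/
def Over.f (P : Q.Over F) : ℕ :=
  letI := P.inclusion.toAlgebra
  Ideal.inertiaDeg' Q.ideal P.1.ideal

end Place

open Classical in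
/-- The place `(t = ∞)` of the rational function field `K(t)`, where `t = RatFunc.X`: its valuation
ring consists of the fractions `a / b` with `deg a ≤ deg b`. -/
def placeAtInfinity (K : Type*) [Field K] : Place K (RatFunc K) where
  valuationRing := (RatFunc.inftyValuation K).valuationSubring
  const_lt := by
    have hX : RatFunc.inftyValuation K (1 / RatFunc.X) = WithZero.exp (-1) :=
      RatFunc.inftyValuation.X_inv K
    refine lt_of_le_of_ne ?_ ?_
    · rintro _ ⟨k, rfl⟩
      change RatFunc.inftyValuation K (algebraMap K (RatFunc K) k) ≤ 1
      rcases eq_or_ne k 0 with rfl | hk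
      · simp
      · rw [RatFunc.algebraMap_eq_C, RatFunc.inftyValuation.C K hk]
    · intro h
      have hmem : (1 / RatFunc.X : RatFunc K) ∈
          (RatFunc.inftyValuation K).valuationSubring.toSubring := by
        change RatFunc.inftyValuation K (1 / RatFunc.X) ≤ 1
        rw [hX, ← WithZero.exp_zero, WithZero.exp_le_exp]
        norm_num
      rw [← h] at hmem
      obtain ⟨k, hk⟩ := hmem
      rw [RatFunc.algebraMap_eq_C] at hk
      rw [← hk] at hX
      rcases eq_or_ne k 0 with rfl | hk0
      · rw [map_zero, map_zero] at hX
        exact WithZero.exp_ne_zero hX.symm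
      · rw [RatFunc.inftyValuation.C K hk0, ← WithZero.exp_zero, WithZero.exp_inj] at hX
        norm_num at hX
  lt_top := by
    refine lt_top_iff_ne_top.2 fun h => ?_
    have hmem : (RatFunc.X : RatFunc K) ∈ (RatFunc.inftyValuation K).valuationSubring := by
      rw [h]; trivial
    have hle : RatFunc.inftyValuation K RatFunc.X ≤ 1 := hmem
    rw [RatFunc.inftyValuation.X, ← WithZero.exp_zero, WithZero.exp_le_exp] at hle
    norm_num at hle

/-- The polynomial
`P_t(T) = T^(r+1) + 2 T^((r+1)/2) - T^3 + T^2 (t^(r+1) + 1) - T t^(r+1) + 1` over `K(t)`. -/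
def curvePoly (K : Type*) [Field K] (r : ℕ) : (RatFunc K)[X] :=
  X ^ (r + 1) + 2 * X ^ ((r + 1) / 2) - X ^ 3 + X ^ 2 * C ((RatFunc.X : RatFunc K) ^ (r + 1) + 1)
    - X * C ((RatFunc.X : RatFunc K) ^ (r + 1)) + 1

end

/-! The places over `t = ∞` are the poles of `t`. The equation of the curve reads
`t ^ (r + 1) * x * (x - 1) = -N(x)` with `N` a polynomial over `K`, and `N(0) = 1` and `N(1) = 4`
are nonzero, so a zero of `x` or of `x - 1` is a pole of `t`. At a pole of `x` the function
`w = t ^ ((r + 1) / 2) * (x - 1) / x ^ ((r + 1) / 2)` has `w² = -1`. Hence `x` is there a unit times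
`(x / t) ^ ((r + 1) / 2)`, so `t` is a unit times `(x / t) ^ ((r - 1) / 2)`, and the ramification
index is at least `(r - 1) / 2`. If `-1` is not a square, the value of `w` makes the relative degree
at least `2`. If `i² = -1`, then `w` takes both values `± i` at poles of `x`: indeed `w² = H(x⁻¹)`
for a polynomial `H` that is not a square, having a simple zero at `1`, so that `K[x⁻¹, w]` is the
coordinate ring of the curve `w² = H(y)`, which passes through `(0, ± i)`. The places found so far
contribute at least `1 + 1 + 2 * (r - 1) / 2 = r + 1` to `∑ e * f`, which is at most the degree of
the extension, hence at most `r + 1`; so these are all the places and each bound is an equality. The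
extension is separable since the derivative of the curve polynomial has a pole wherever `x` has a
zero. -/

open Polynomial IsLocalRing

section Center

theorem exists_notMem_dvd_mul_or_dvd_mul {S : Type*} [CommRing S] [IsDedekindDomain S]
    {q : Ideal S} [q.IsPrime] (hq : q ≠ ⊥) (a b : S) : ∃ s ∉ q, a ∣ s * b ∨ b ∣ s * a := by
  have := IsLocalization.AtPrime.isDiscreteValuationRing_of_dedekind_domain S hq
    (Localization.AtPrime q)
  have exists_of_dvd (a b : S)
      (h : algebraMap S (Localization.AtPrime q) a ∣ algebraMap S (Localization.AtPrime q) b) :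
      ∃ s ∉ q, a ∣ s * b := by
    obtain ⟨z, hz⟩ := h
    obtain ⟨⟨c, s⟩, hcs⟩ := IsLocalization.surj q.primeCompl z
    refine ⟨s, s.2, c, IsLocalization.injective (Localization.AtPrime q)
      q.primeCompl_le_nonZeroDivisors ?_⟩
    rw [map_mul, map_mul, hz, ← hcs]
    ring
  rcases ValuationRing.dvd_total (algebraMap S (Localization.AtPrime q) a) (algebraMap S _ b)
    with h | h
  · obtain ⟨s, hs, hdvd⟩ := exists_of_dvd a b h
    exact ⟨s, hs, .inl hdvd⟩
  · obtain ⟨s, hs, hdvd⟩ := exists_of_dvd b a h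
    exact ⟨s, hs, .inr hdvd⟩

variable {S F : Type*} [CommRing S] [IsDedekindDomain S] [Field F] [Algebra S F]
  [IsFractionRing S F]

theorem isLocalization_atPrime_under_maximalIdeal (O : ValuationSubring F) [Algebra S O]
    [IsScalarTower S O F] (hO : (maximalIdeal O).under S ≠ ⊥) :
    IsLocalization.AtPrime O ((maximalIdeal O).under S) := by
  set q := (maximalIdeal O).under S with hq
  have isUnit_iff (s : S) : IsUnit (algebraMap S O s) ↔ s ∉ q := by
    rw [hq, Ideal.mem_comap, mem_maximalIdeal, mem_nonunits_iff, not_not]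
  refine ⟨⟨fun s => (isUnit_iff s).2 s.2, fun z => ?_, fun {a b} hab => ⟨1, ?_⟩⟩⟩
  · suffices h : ∃ a s : S, s ∉ q ∧ z * algebraMap S O s = algebraMap S O a from
      let ⟨a, s, hs, has⟩ := h; ⟨⟨a, s, hs⟩, has⟩
    obtain ⟨a, b, hb, hz⟩ := IsFractionRing.div_surjective (A := S) (z : F)
    replace hb : algebraMap S F b ≠ 0 := IsFractionRing.to_map_ne_zero_of_mem_nonZeroDivisors hb
    obtain ⟨s, hs, ⟨c, hc⟩ | ⟨c, hc⟩⟩ := exists_notMem_dvd_mul_or_dvd_mul hO a b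
    · have hzc : z * algebraMap S O c = algebraMap S O s := by
        refine FaithfulSMul.algebraMap_injective O F ?_
        replace hc := congrArg (algebraMap S F) hc
        rw [map_mul, map_mul] at hc
        rw [map_mul, ← IsScalarTower.algebraMap_apply, ← IsScalarTower.algebraMap_apply,
          show algebraMap O F z = z from rfl, ← hz, div_mul_eq_mul_div, ← hc,
          mul_div_cancel_right₀ _ hb]
      refine ⟨s, c, (isUnit_iff c).1 ?_, hzc⟩
      exact isUnit_of_mul_isUnit_right (hzc ▸ (isUnit_iff s).2 hs)
    · refine ⟨c, s, hs, FaithfulSMul.algebraMap_injective O F ?_⟩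
      replace hc := congrArg (algebraMap S F) hc
      rw [map_mul, map_mul] at hc
      rw [map_mul, ← IsScalarTower.algebraMap_apply, ← IsScalarTower.algebraMap_apply,
        show algebraMap O F z = z from rfl, ← hz, div_mul_eq_mul_div, mul_comm, hc,
        mul_div_cancel_left₀ _ hb]
  · refine congrArg _ (IsFractionRing.injective S F ?_)
    rw [IsScalarTower.algebraMap_apply S O F, hab, ← IsScalarTower.algebraMap_apply]

end Center

section AtPrime

theorem le_of_isLocalization_atPrime {S F : Type*} [CommRing S] [Field F] [Algebra S F]
    {O O' : ValuationSubring F} [Algebra S O] [Algebra S O'] [IsScalarTower S O F]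
    [IsScalarTower S O' F] {q : Ideal S} [q.IsPrime] [IsLocalization.AtPrime O q]
    (hq : (maximalIdeal O').under S ≤ q) : O ≤ O' := by
  intro z hz
  obtain ⟨⟨a, s, hs⟩, has⟩ := IsLocalization.surj q.primeCompl (⟨z, hz⟩ : O)
  have hsO' : IsUnit (algebraMap S O' s) := by
    rw [← not_not (a := IsUnit _), ← mem_nonunits_iff, ← mem_maximalIdeal, ← Ideal.mem_comap]
    exact fun hsO' => hs (hq hsO')
  obtain ⟨w, hw⟩ := hsO'.dvd (a := algebraMap S O' a)
  have hs0 : algebraMap S F s ≠ 0 := by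
    rw [IsScalarTower.algebraMap_apply S O' F]
    exact (hsO'.map (algebraMap O' F)).ne_zero
  replace has := congrArg (algebraMap O F) has
  replace hw := congrArg (algebraMap O' F) hw
  rw [map_mul, ← IsScalarTower.algebraMap_apply, ← IsScalarTower.algebraMap_apply] at has hw
  rw [mul_comm, hw] at has
  exact (mul_left_cancel₀ hs0 has : z = w) ▸ w.2

variable {S : Type*} (O : Type*) [CommRing S] [CommRing O] [IsLocalRing O] [Algebra S O]
  (q : Ideal S)

theorem ramificationIdx_maximalIdeal_of_isLocalization_atPrime [q.IsPrime]
    [IsLocalization.AtPrime O q] : (maximalIdeal O).ramificationIdx S = 1 := by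
  have := Algebra.EssFiniteType.of_isLocalization O q.primeCompl
  have := Algebra.FormallyUnramified.of_isLocalization (Rₘ := O) q.primeCompl
  exact Ideal.ramificationIdx_eq_one _ _

theorem inertiaDeg_maximalIdeal_of_isLocalization_atPrime [q.IsMaximal]
    [IsLocalization.AtPrime O q] : (maximalIdeal O).inertiaDeg S = 1 := by
  have : (maximalIdeal O).LiesOver q :=
    ⟨(IsLocalization.AtPrime.under_maximalIdeal O q).symm⟩
  rw [Ideal.inertiaDeg_eq_of_isMaximal q]
  let : Field (S ⧸ q) := Ideal.Quotient.field q
  refine finrank_eq_one 1 one_ne_zero fun w => ?_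
  obtain ⟨c, rfl⟩ := (IsLocalization.AtPrime.equivQuotMaximalIdeal q O).surjective w
  obtain ⟨c, rfl⟩ := Ideal.Quotient.mk_surjective c
  refine ⟨Ideal.Quotient.mk q c, ?_⟩
  rw [Algebra.smul_def, mul_one, IsLocalization.AtPrime.equivQuotMaximalIdeal_apply_mk]
  rfl

end AtPrime

namespace Place

variable {K E F : Type*} [Field K] [Field E] [Field F] [Algebra K E] [Algebra K F] [Algebra E F]
  {Q : Place K E}

theorem algebraMap_mem (P : Place K F) (a : K) : algebraMap K F a ∈ P.valuationRing :=
  P.const_lt.le ⟨a, rfl⟩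

theorem mem_ideal {P : Place K F} {z : P.valuationRing} :
    z ∈ P.ideal ↔ P.valuationRing.valuation z < 1 :=
  P.valuationRing.valuation_lt_one_iff z

theorem ideal_ne_bot (P : Place K F) : P.ideal ≠ ⊥ := by
  obtain ⟨z, -, hz⟩ := SetLike.exists_of_lt P.lt_top
  rw [← ValuationSubring.valuation_le_one_iff, not_le] at hz
  have hz' : P.valuationRing.valuation z⁻¹ < 1 := by
    rw [map_inv₀]
    exact inv_lt_one_of_one_lt₀ hz
  refine (Submodule.ne_bot_iff _).2
    ⟨⟨z⁻¹, (P.valuationRing.valuation_le_one_iff _).1 hz'.le⟩, mem_ideal.2 hz', fun h => ?_⟩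
  rw [show z = 0 from inv_eq_zero.1 (congrArg Subtype.val h), map_zero] at hz
  exact hz.not_ge zero_le_one

theorem LiesOver.valuation_le_one_iff {P : Place K F} (h : P.LiesOver Q) (z : E) :
    P.valuationRing.valuation (algebraMap E F z) ≤ 1 ↔ Q.valuationRing.valuation z ≤ 1 := by
  rw [ValuationSubring.valuation_le_one_iff, ValuationSubring.valuation_le_one_iff,
    ← show P.valuationRing.comap (algebraMap E F) = Q.valuationRing from h]
  rfl

theorem LiesOver.valuation_lt_one_iff {P : Place K F} (h : P.LiesOver Q) (z : E) :
    P.valuationRing.valuation (algebraMap E F z) < 1 ↔ Q.valuationRing.valuation z < 1 := by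
  rcases eq_or_ne z 0 with rfl | hz
  · simp
  rw [Valuation.val_lt_one_iff _ hz, Valuation.val_lt_one_iff _ (by simpa using hz), ← not_le,
    ← not_le, ← map_inv₀ (algebraMap E F), h.valuation_le_one_iff]

instance (P : Place K F) : P.ideal.IsMaximal := maximalIdeal.isMaximal _

namespace Over

instance (P : Q.Over F) : Algebra Q.valuationRing P.1.valuationRing := P.inclusion.toAlgebra

instance (P : Q.Over F) : IsScalarTower Q.valuationRing P.1.valuationRing F :=
  .of_algebraMap_eq fun _ => rfl

instance (P : Q.Over F) : FaithfulSMul Q.valuationRing P.1.valuationRing := by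
  have := FaithfulSMul.trans Q.valuationRing E F
  exact .tower_bot Q.valuationRing P.1.valuationRing F

instance (P : Q.Over F) : P.1.ideal.LiesOver Q.ideal :=
  ⟨Ideal.ext fun z => by
    rw [Ideal.mem_comap, mem_ideal, mem_ideal]
    exact (P.2.valuation_lt_one_iff (z : E)).symm⟩

theorem mem_of_mem_integralClosure (P : Q.Over F) {z : F}
    (hz : z ∈ integralClosure Q.valuationRing F) : z ∈ P.1.valuationRing := by
  obtain ⟨z, rfl⟩ := IsIntegralClosure.isIntegral_iff (A := P.1.valuationRing) |>.1
    (IsIntegral.tower_top (A := P.1.valuationRing) hz)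
  exact z.2

instance (P : Q.Over F) : Algebra (integralClosure Q.valuationRing F) P.1.valuationRing :=
  ((integralClosure Q.valuationRing F).val.toRingHom.codRestrict P.1.valuationRing.toSubring
    fun z => P.mem_of_mem_integralClosure z.2).toAlgebra

instance (P : Q.Over F) : IsScalarTower (integralClosure Q.valuationRing F) P.1.valuationRing F :=
  .of_algebraMap_eq fun _ => rfl

instance (P : Q.Over F) :
    IsScalarTower Q.valuationRing (integralClosure Q.valuationRing F) P.1.valuationRing :=
  .of_algebraMap_eq fun _ => rfl

/-- The center of a place on the integral closure of the valuation ring below it: the prime ideal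
of the functions that vanish at the place. -/
abbrev center (P : Q.Over F) : Ideal (integralClosure Q.valuationRing F) :=
  P.1.ideal.under (integralClosure Q.valuationRing F)

instance (P : Q.Over F) : P.1.ideal.LiesOver P.center := ⟨rfl⟩

instance (P : Q.Over F) : P.center.LiesOver Q.ideal := .tower_bot P.1.ideal P.center Q.ideal

instance (P : Q.Over F) : P.center.IsMaximal := .of_liesOver_isMaximal P.center Q.ideal

theorem center_ne_bot (P : Q.Over F) : P.center ≠ ⊥ :=
  Ideal.ne_bot_of_liesOver_of_ne_bot Q.ideal_ne_bot P.center

variable [IsDiscreteValuationRing Q.valuationRing] [FiniteDimensional E F] [Algebra.IsSeparable E F]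

instance : IsDedekindDomain (integralClosure Q.valuationRing F) :=
  integralClosure.isDedekindDomain _ E F

instance : IsFractionRing (integralClosure Q.valuationRing F) F :=
  integralClosure.isFractionRing_of_finite_extension E F

instance : Module.Finite Q.valuationRing (integralClosure Q.valuationRing F) :=
  IsIntegralClosure.finite _ E F _

theorem isLocalization_center (P : Q.Over F) : IsLocalization.AtPrime P.1.valuationRing P.center :=
  isLocalization_atPrime_under_maximalIdeal P.1.valuationRing P.center_ne_bot

theorem center_injective : Function.Injective (center : Q.Over F → _) := by
  intro P P' h
  have := P.isLocalization_center
  have := P'.isLocalization_center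
  exact Subtype.ext <| Place.ext <|
    (le_of_isLocalization_atPrime h.ge).antisymm (le_of_isLocalization_atPrime h.le)

theorem e_eq_ramificationIdx_center (P : Q.Over F) :
    P.e = P.center.ramificationIdx Q.valuationRing := by
  have := P.isLocalization_center
  have := IsLocalization.flat P.1.valuationRing P.center.primeCompl
  have := IsLocalization.isDedekindDomain (integralClosure Q.valuationRing F)
    P.center.primeCompl_le_nonZeroDivisors P.1.valuationRing
  have hS : P.1.ideal.ramificationIdx (integralClosure Q.valuationRing F) = 1 :=
    ramificationIdx_maximalIdeal_of_isLocalization_atPrime P.1.valuationRing P.center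
  have he : P.e = P.1.ideal.ramificationIdx Q.valuationRing :=
    Ideal.ramificationIdx'_eq_ramificationIdx _ _ Q.ideal_ne_bot
  rw [he, Ideal.ramificationIdx_tower P.center, hS, mul_one]

theorem f_eq_inertiaDeg_center (P : Q.Over F) : P.f = P.center.inertiaDeg Q.valuationRing := by
  have := P.isLocalization_center
  have hS : P.1.ideal.inertiaDeg (integralClosure Q.valuationRing F) = 1 :=
    inertiaDeg_maximalIdeal_of_isLocalization_atPrime P.1.valuationRing P.center
  have hf : P.f = P.1.ideal.inertiaDeg Q.valuationRing :=
    Ideal.inertiaDeg'_eq_inertiaDeg _ _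
  rw [hf, Ideal.inertiaDeg_tower P.center, hS, mul_one]

theorem e_pos (P : Q.Over F) : 0 < P.e :=
  P.e_eq_ramificationIdx_center ▸ Ideal.ramificationIdx_pos _ _

theorem f_pos (P : Q.Over F) : 0 < P.f :=
  P.f_eq_inertiaDeg_center ▸ Ideal.inertiaDeg_pos _ _

theorem sum_e_mul_f_le_finrank (s : Finset (Q.Over F)) :
    ∑ P ∈ s, P.e * P.f ≤ Module.finrank E F := by
  let S := integralClosure Q.valuationRing F
  have : Fintype (Q.ideal.primesOver S) := (Algebra.QuasiFinite.finite_primesOver Q.ideal).fintype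
  have : Module.IsTorsionFree Q.valuationRing S := inferInstance
  let toPrime (P : Q.Over F) : Q.ideal.primesOver S := ⟨P.center, inferInstance, inferInstance⟩
  have toPrime_injective : Function.Injective toPrime := fun P P' h =>
    center_injective (congrArg Subtype.val h)
  calc
    ∑ P ∈ s, P.e * P.f
    _ = ∑ q ∈ s.map ⟨toPrime, toPrime_injective⟩,
          q.1.ramificationIdx Q.valuationRing * q.1.inertiaDeg Q.valuationRing := by
        simp only [Finset.sum_map, e_eq_ramificationIdx_center, f_eq_inertiaDeg_center]; rfl
    _ ≤ ∑ q : Q.ideal.primesOver S,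
          q.1.ramificationIdx Q.valuationRing * q.1.inertiaDeg Q.valuationRing :=
        Finset.sum_le_univ_sum_of_nonneg fun _ => Nat.zero_le _
    _ = Module.finrank Q.valuationRing S := Q.ideal.sum_ramification_inertia_eq_finrank S
    _ = Module.finrank E F := (IsFractionRing.finrank_eq ..).symm

end Over
end Place

section Quadratic

variable {K F : Type*} [Field K] [Field F] [Algebra K F]

theorem X_sq_sub_C_dvd_of_aevalAeval_eq_zero {y w : F} (hy : Transcendental K y) {H : K[X]}
    (hH : ¬ IsSquare H) (hw : w ^ 2 = aeval y H) {p : K[X][X]} (hp : aevalAeval y w p = 0) :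
    X ^ 2 - C H ∣ p := by
  let : Algebra K[X] F := (aeval y).toAlgebra
  have algebraMap_injective : Function.Injective (algebraMap K[X] F) :=
    transcendental_iff_injective.1 hy
  have : FaithfulSMul K[X] F := (faithfulSMul_iff_algebraMap_injective _ _).2 algebraMap_injective
  have aeval_eq_zero : aeval w (X ^ 2 - C H) = 0 := by
    rw [map_sub, map_pow, aeval_X, aeval_C, hw]
    exact sub_self _
  have hmonic : (X ^ 2 - C H).Monic := monic_X_pow_sub_C H two_ne_zero
  have two_le_natDegree : 2 ≤ (minpoly K[X] w).natDegree := by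
    rw [minpoly.two_le_natDegree_iff ⟨_, hmonic, aeval_eq_zero⟩]
    rintro ⟨q, rfl⟩
    exact hH ⟨q, algebraMap_injective (by rw [map_mul, ← sq, hw]; rfl)⟩
  have minpoly_eq : X ^ 2 - C H = minpoly K[X] w := by
    refine minpoly.IsIntegrallyClosed.unique_of_degree_le_degree_minpoly hmonic aeval_eq_zero ?_
    rw [degree_X_pow_sub_C two_pos,
      degree_eq_natDegree (minpoly.ne_zero ⟨_, hmonic, aeval_eq_zero⟩)]
    exact_mod_cast two_le_natDegree
  have : IsScalarTower K K[X] F := .of_algebraMap_eq fun a => (aeval_C y a).symm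
  have algebraMap_X : algebraMap K[X] F X = y := aeval_X y
  have aevalAeval_eq : (aeval w : K[X][X] →ₐ[K[X]] F).restrictScalars K = aevalAeval y w :=
    algHom_ext' (by ext; simpa using algebraMap_X) (by simp)
  rw [← aevalAeval_eq, AlgHom.restrictScalars_apply] at hp
  rw [minpoly_eq]
  exact minpoly.isIntegrallyClosed_dvd ⟨_, hmonic, aeval_eq_zero⟩ hp

end Quadratic

namespace Place

variable {K F : Type*} [Field K] [Field F] [Algebra K F]

theorem valuation_algebraMap (P : Place K F) {a : K} (ha : a ≠ 0) :
    P.valuationRing.valuation (algebraMap K F a) = 1 := by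
  refine le_antisymm ((P.valuationRing.valuation_le_one_iff _).2 (P.algebraMap_mem a)) ?_
  have h := (P.valuationRing.valuation_le_one_iff _).2 (P.algebraMap_mem a⁻¹)
  rw [map_inv₀, map_inv₀] at h
  exact (inv_le_one₀ (zero_lt_iff.2 (by simpa using ha))).1 h

/-- The function `z` takes the value `c` at the place `P`, that is, `z - c` vanishes at `P`. Only
values in the field of constants are considered, so a function that is regular at a place of
degree greater than one may have no value there. -/
def HasValue (P : Place K F) (z : F) (c : K) : Prop :=
  P.valuationRing.valuation (z - algebraMap K F c) < 1

variable {P : Place K F} {z : F} {c d : K}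

theorem hasValue_zero : P.HasValue z 0 ↔ P.valuationRing.valuation z < 1 := by
  rw [HasValue, map_zero, sub_zero]

theorem hasValue_sub_algebraMap_zero : P.HasValue (z - algebraMap K F c) 0 ↔ P.HasValue z c :=
  hasValue_zero

theorem HasValue.mem (h : P.HasValue z c) : z ∈ P.valuationRing := by
  rw [← sub_add_cancel z (algebraMap K F c)]
  exact add_mem ((P.valuationRing.valuation_le_one_iff _).1 h.le) (P.algebraMap_mem c)

theorem HasValue.valuation_eq_one (h : P.HasValue z c) (hc : c ≠ 0) :
    P.valuationRing.valuation z = 1 := by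
  rw [HasValue, ← P.valuation_algebraMap hc] at h
  rw [← P.valuation_algebraMap hc]
  exact Valuation.map_eq_of_sub_lt _ h

theorem HasValue.eq (h : P.HasValue z c) (h' : P.HasValue z d) : c = d := by
  by_contra hcd
  refine (P.valuation_algebraMap (sub_ne_zero.2 hcd)).not_lt ?_
  rw [map_sub, ← sub_sub_sub_cancel_left _ _ z]
  exact Valuation.map_sub_lt _ h' h

theorem valuation_aeval_le_one (hz : z ∈ P.valuationRing) (p : K[X]) :
    P.valuationRing.valuation (aeval z p) ≤ 1 := by
  rw [P.valuationRing.valuation_le_one_iff, aeval_eq_sum_range]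
  refine sum_mem fun i _ => ?_
  rw [Algebra.smul_def]
  exact mul_mem (P.algebraMap_mem _) (pow_mem hz i)

theorem HasValue.aeval (h : P.HasValue z c) (p : K[X]) : P.HasValue (aeval z p) (p.eval c) := by
  obtain ⟨q, hq⟩ := X_sub_C_dvd_sub_C_eval (a := c) (p := p)
  have hsub : Polynomial.aeval z p - algebraMap K F (p.eval c) =
      (z - algebraMap K F c) * Polynomial.aeval z q := by
    simpa only [map_sub, map_mul, aeval_C, aeval_X] using congrArg (Polynomial.aeval z) hq
  rw [HasValue, hsub, map_mul]
  exact mul_lt_one_of_lt_of_le h (valuation_aeval_le_one h.mem q)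

theorem HasValue.ne {P' : Place K F} (h : P.HasValue z c) (h' : P'.HasValue z d) (hcd : c ≠ d) :
    P ≠ P' := by
  rintro rfl
  exact hcd (h.eq h')

theorem HasValue.ne_of_inv {P' : Place K F} (h : P.HasValue z c) (h' : P'.HasValue z⁻¹ 0)
    (hz : z ≠ 0) : P ≠ P' := by
  rintro rfl
  rw [hasValue_zero, ← Valuation.one_lt_val_iff _ hz, ← not_le] at h'
  exact h' ((P.valuationRing.valuation_le_one_iff _).2 h.mem)

theorem LiesOver.hasValue_algebraMap_iff {E : Type*} [Field E] [Algebra K E] [Algebra E F]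
    [IsScalarTower K E F] {Q : Place K E} (h : P.LiesOver Q) {z : E} :
    P.HasValue (algebraMap E F z) c ↔ Q.HasValue z c := by
  rw [HasValue, HasValue, IsScalarTower.algebraMap_apply K E F, ← map_sub, h.valuation_lt_one_iff]

theorem exists_of_algHom {S L : Type*} [CommRing S] [Algebra K S] [CommRing L] [Nontrivial L]
    [Algebra K L] (f : S →ₐ[K] F) (φ : S →ₐ[K] L) (hker : RingHom.ker f < RingHom.ker φ) :
    ∃ P : Place K F, ∀ s, φ s = 0 → P.HasValue (f s) 0 := by
  let g := f.toRingHom.rangeRestrict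
  have map_ne_top : (RingHom.ker φ).map g ≠ ⊤ := by
    intro h
    obtain ⟨s, hs, hs1⟩ :=
      (Ideal.mem_map_iff_of_surjective g f.toRingHom.rangeRestrict_surjective).1
        (h ▸ Submodule.mem_top : (1 : f.toRingHom.range) ∈ _)
    have h1 : s - 1 ∈ RingHom.ker φ := hker.le <| by
      rw [RingHom.mem_ker, map_sub, map_one, sub_eq_zero]
      exact congrArg Subtype.val hs1
    rw [RingHom.mem_ker, map_sub, hs, map_one, zero_sub, neg_eq_zero] at h1
    exact one_ne_zero h1
  obtain ⟨O, range_le, hO⟩ := Ideal.image_subset_nonunits_valuationSubring _ map_ne_top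
  have valuation_lt_one (s : S) (hs : φ s = 0) : O.valuation (f s) < 1 :=
    hO ⟨g s, Ideal.mem_map_of_mem g hs, rfl⟩
  have algebraMap_mem (a : K) : algebraMap K F a ∈ O := range_le ⟨algebraMap K S a, f.commutes a⟩
  -- The zero `f s ≠ 0` of the place excludes the trivial valuation rings `K` and `F`.
  obtain ⟨s, hφs, hfs⟩ := SetLike.exists_of_lt hker
  rw [RingHom.mem_ker] at hφs hfs
  have hs := valuation_lt_one s hφs
  rw [Valuation.val_lt_one_iff _ hfs, ← not_le, ValuationSubring.valuation_le_one_iff] at hs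
  refine ⟨⟨O, lt_of_le_of_ne ?_ fun h => hs ?_, lt_top_iff_ne_top.2 fun h => hs (h ▸ trivial)⟩,
    fun s h => hasValue_zero.2 (valuation_lt_one s h)⟩
  · rintro _ ⟨a, rfl⟩
    exact algebraMap_mem a
  · obtain ⟨a, ha⟩ := h.ge ((O.valuation_le_one_iff _).1 (valuation_lt_one s hφs).le)
    rw [← ha, ← map_inv₀]
    exact algebraMap_mem a⁻¹

theorem exists_hasValue_of_transcendental (hz : Transcendental K z) (c : K) :
    ∃ P : Place K F, P.HasValue z c := by
  have hker : RingHom.ker (Polynomial.aeval z : K[X] →ₐ[K] F) <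
      RingHom.ker (Polynomial.aeval c : K[X] →ₐ[K] K) := by
    rw [(RingHom.injective_iff_ker_eq_bot _).1 (transcendental_iff_injective.1 hz),
      bot_lt_iff_ne_bot]
    exact (Submodule.ne_bot_iff _).2
      ⟨X - C c, by rw [RingHom.mem_ker, map_sub, aeval_X, aeval_C]; exact sub_self c,
        X_sub_C_ne_zero c⟩
  obtain ⟨P, hP⟩ := exists_of_algHom _ _ hker
  have hz : Polynomial.aeval z (X - C c) = z - algebraMap K F c := by simp
  exact ⟨P, hasValue_sub_algebraMap_zero.1 (hz ▸ hP (X - C c) (by simp))⟩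

theorem exists_hasValue_of_sq_eq_aeval (hz : Transcendental K z) {w : F} {H : K[X]}
    (hH : ¬ IsSquare H) (hw : w ^ 2 = Polynomial.aeval z H) (hd : d ^ 2 = H.eval c) :
    ∃ P : Place K F, P.HasValue z c ∧ P.HasValue w d := by
  let f : K[X][X] →ₐ[K] F := aevalAeval z w
  let φ : K[X][X] →ₐ[K] K := aevalAeval c d
  have hfz : f (C (X - C c)) = z - algebraMap K F c := by simp [f]
  have hfw : f (X - C (C d)) = w - algebraMap K F d := by simp [f]
  have hφz : φ (C (X - C c)) = 0 := by simp [φ]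
  have hφw : φ (X - C (C d)) = 0 := by simp [φ]
  have hker : RingHom.ker f < RingHom.ker φ := by
    refine lt_of_le_of_ne (fun p hp => ?_) fun h => ?_
    · obtain ⟨q, rfl⟩ := X_sq_sub_C_dvd_of_aevalAeval_eq_zero hz hH hw hp
      simp [φ, hd]
    · have hzc : z = algebraMap K F c := sub_eq_zero.1 (hfz ▸ h.ge hφz)
      exact hz (hzc ▸ isAlgebraic_algebraMap c)
  obtain ⟨P, hP⟩ := exists_of_algHom f φ hker
  exact ⟨P, hasValue_sub_algebraMap_zero.1 (hfz ▸ hP _ hφz),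
    hasValue_sub_algebraMap_zero.1 (hfw ▸ hP _ hφw)⟩

end Place

namespace Place.Over

variable {K E F : Type*} [Field K] [Field E] [Field F] [Algebra K E] [Algebra K F] [Algebra E F]
  {Q : Place K E} [IsDiscreteValuationRing Q.valuationRing] [FiniteDimensional E F]
  [Algebra.IsSeparable E F]

theorem surjective_and_eq_of_finrank_le_sum {ι : Type*} [Fintype ι] {P : ι → Q.Over F}
    (hP : Function.Injective P) {ε φ : ι → ℕ} (hε : ∀ i, ε i ≤ (P i).e) (hφ : ∀ i, φ i ≤ (P i).f)
    (h : Module.finrank E F ≤ ∑ i, ε i * φ i) :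
    Function.Surjective P ∧ ∀ i, (P i).e = ε i ∧ (P i).f = φ i := by
  have mul_le_mul (i : ι) : ε i * φ i ≤ (P i).e * (P i).f := Nat.mul_le_mul (hε i) (hφ i)
  have sum_le : ∑ i, (P i).e * (P i).f ≤ Module.finrank E F := by
    simpa only [Finset.sum_map, Function.Embedding.coeFn_mk] using
      sum_e_mul_f_le_finrank (Finset.univ.map ⟨P, hP⟩)
  constructor
  · by_contra! hsurj
    obtain ⟨P', hP'⟩ := not_forall.1 hsurj
    have hlt := sum_e_mul_f_le_finrank
      (Finset.cons P' (Finset.univ.map ⟨P, hP⟩) (by simpa using hP'))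
    rw [Finset.sum_cons, Finset.sum_map] at hlt
    have := Nat.mul_pos P'.e_pos P'.f_pos
    have := Finset.sum_le_sum fun i (_ : i ∈ Finset.univ) => mul_le_mul i
    simp only [Function.Embedding.coeFn_mk] at hlt
    omega
  · intro i
    have heq : ε i * φ i = (P i).e * (P i).f :=
      (Finset.sum_eq_sum_iff_of_le fun i _ => mul_le_mul i).1
        ((Finset.sum_le_sum fun i _ => mul_le_mul i).antisymm (sum_le.trans h)) i
        (Finset.mem_univ i)
    obtain ⟨he, hf⟩ := mul_pos_iff.1 (heq ▸ Nat.mul_pos (P i).e_pos (P i).f_pos) |>.resolve_right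
      fun h => absurd h.1 (Nat.not_lt_zero _)
    constructor <;> nlinarith [hε i, hφ i]

theorem le_e (P : Q.Over F) {u : F} (hu : P.1.valuationRing.valuation u < 1) {k : ℕ}
    (h : ∀ z : E, Q.valuationRing.valuation z < 1 →
      P.1.valuationRing.valuation (algebraMap E F z) ≤ P.1.valuationRing.valuation u ^ k) :
    k ≤ P.e := by
  have map_le : Q.ideal.map (algebraMap Q.valuationRing P.1.valuationRing) ≤ P.1.ideal ^ k := by
    rw [Ideal.map_le_iff_le_comap]
    intro z hz
    let u' : P.1.valuationRing := ⟨u, (P.1.valuationRing.valuation_le_one_iff u).1 hu.le⟩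
    obtain ⟨a, ha⟩ := (P.1.valuationRing.valuation_le_iff _ _).1
      ((h z (mem_ideal.1 hz)).trans_eq (map_pow ..).symm)
    have hzu : algebraMap _ P.1.valuationRing z = a * u' ^ k := Subtype.ext ha.symm
    rw [Ideal.mem_comap, hzu]
    exact Ideal.mul_mem_left _ a (Ideal.pow_mem_pow (mem_ideal.2 hu) k)
  refine le_csSup ?_ map_le
  by_contra hbdd
  -- The supremum of an unbounded set of natural numbers is `0` by convention.
  refine P.e_pos.ne' (Ideal.ramificationIdx'_eq_zero fun n => ?_)
  exact not_bddAbove_iff.1 hbdd n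

theorem two_le_f (P : Q.Over F) {w : F} (hw : P.1.valuationRing.valuation w ≤ 1)
    (h : ∀ z : E, Q.valuationRing.valuation z ≤ 1 →
      1 ≤ P.1.valuationRing.valuation (w - algebraMap E F z)) : 2 ≤ P.f := by
  by_contra! hf
  replace hf : Module.finrank (Q.valuationRing ⧸ Q.ideal) (P.1.valuationRing ⧸ P.1.ideal) = 1 := by
    rw [← Ideal.inertiaDeg'_algebraMap]
    exact le_antisymm (Nat.lt_succ_iff.1 hf) P.f_pos
  let : Field (Q.valuationRing ⧸ Q.ideal) := Ideal.Quotient.field Q.ideal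
  let w' : P.1.valuationRing := ⟨w, (P.1.valuationRing.valuation_le_one_iff w).1 hw⟩
  obtain ⟨z, hz⟩ := (Module.Free.bijective_algebraMap_of_finrank_eq_one hf).surjective
    (Ideal.Quotient.mk P.1.ideal w')
  obtain ⟨z, rfl⟩ := Ideal.Quotient.mk_surjective z
  rw [Ideal.Quotient.algebraMap_mk_of_liesOver, eq_comm, Ideal.Quotient.eq, mem_ideal] at hz
  exact (h z (Q.valuationRing.valuation_le_one z)).not_gt hz

end Place.Over

namespace placeAtInfinity

variable (K : Type*) [Field K]

instance : IsDiscreteValuationRing (placeAtInfinity K).valuationRing := by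
  classical
  exact inferInstanceAs (IsDiscreteValuationRing (RatFunc.inftyValuation K).valuationSubring)

variable {K}

theorem valuation_le_one_iff {z : RatFunc K} :
    (placeAtInfinity K).valuationRing.valuation z ≤ 1 ↔ z.intDegree ≤ 0 := by
  classical
  rw [ValuationSubring.valuation_le_one_iff]
  refine Valuation.mem_valuationSubring_iff (RatFunc.inftyValuation K) z |>.trans ?_
  rcases eq_or_ne z 0 with rfl | hz
  · simp
  · rw [RatFunc.inftyValuation_apply, RatFunc.inftyValuation_of_nonzero K hz, ← WithZero.exp_zero,
      WithZero.exp_le_exp]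

theorem valuation_lt_one_iff {z : RatFunc K} (hz : z ≠ 0) :
    (placeAtInfinity K).valuationRing.valuation z < 1 ↔ z.intDegree < 0 := by
  rw [Valuation.val_lt_one_iff _ hz, ← not_le, valuation_le_one_iff, RatFunc.intDegree_inv,
    not_le, neg_pos]

theorem one_lt_valuation_X : 1 < (placeAtInfinity K).valuationRing.valuation RatFunc.X := by
  rw [← not_le, valuation_le_one_iff, RatFunc.intDegree_X]
  exact one_pos.not_ge

theorem valuation_mul_X_le_one {z : RatFunc K}
    (hz : (placeAtInfinity K).valuationRing.valuation z < 1) :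
    (placeAtInfinity K).valuationRing.valuation (z * RatFunc.X) ≤ 1 := by
  rcases eq_or_ne z 0 with rfl | hz0
  · simp
  rw [valuation_lt_one_iff hz0] at hz
  rw [valuation_le_one_iff, RatFunc.intDegree_mul hz0 RatFunc.X_ne_zero, RatFunc.intDegree_X]
  exact hz

theorem exists_hasValue {z : RatFunc K} (hz : (placeAtInfinity K).valuationRing.valuation z ≤ 1) :
    ∃ c : K, (placeAtInfinity K).HasValue z c := by
  rcases hz.lt_or_eq with hlt | heq
  · exact ⟨0, Place.hasValue_zero.2 hlt⟩
  have hz0 : z ≠ 0 := by rintro rfl; simp at heq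
  have natDegree_eq : z.num.natDegree = z.denom.natDegree := by
    have h₁ := valuation_le_one_iff.1 heq.le
    have h₂ := mt (valuation_lt_one_iff hz0).2 heq.not_lt
    rw [RatFunc.intDegree] at h₁ h₂
    omega
  set c := z.num.leadingCoeff
  have hc : c ≠ 0 := leadingCoeff_ne_zero.2 (RatFunc.num_ne_zero hz0)
  refine ⟨c, ?_⟩
  rw [Place.HasValue]
  rcases eq_or_ne (z - algebraMap K _ c) 0 with h0 | h0
  · rw [h0, map_zero]
    exact zero_lt_one
  have hsub : z - algebraMap K _ c =
      algebraMap K[X] _ (z.num - C c * z.denom) / algebraMap K[X] _ z.denom := by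
    have := RatFunc.algebraMap_ne_zero z.denom_ne_zero
    rw [map_sub, map_mul, sub_div, mul_div_cancel_right₀ _ this, z.num_div_denom]
    rfl
  have num_ne_zero : z.num - C c * z.denom ≠ 0 := by
    rintro h
    exact h0 (by rw [hsub, h, map_zero, zero_div])
  have degree_lt : (z.num - C c * z.denom).degree < z.num.degree := by
    refine degree_sub_lt_left ?_ (RatFunc.num_ne_zero hz0) ?_
    · rw [degree_C_mul hc, degree_eq_natDegree (RatFunc.num_ne_zero hz0), natDegree_eq,
        degree_eq_natDegree z.denom_ne_zero]
    · rw [leadingCoeff_mul, leadingCoeff_C, z.monic_denom, mul_one]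
  rw [valuation_lt_one_iff h0, hsub,
    RatFunc.intDegree_div (RatFunc.algebraMap_ne_zero num_ne_zero)
      (RatFunc.algebraMap_ne_zero z.denom_ne_zero), RatFunc.intDegree_polynomial,
    RatFunc.intDegree_polynomial, ← natDegree_eq, sub_neg, Nat.cast_lt]
  exact natDegree_lt_natDegree num_ne_zero degree_lt

variable {F : Type*} [Field F] [Algebra K F] [Algebra (RatFunc K) F]

theorem liesOver_iff [IsScalarTower K (RatFunc K) F] (P : Place K F) :
    P.LiesOver (placeAtInfinity K) ↔
      1 < P.valuationRing.valuation (algebraMap (RatFunc K) F RatFunc.X) := by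
  classical
  refine ⟨fun h => ?_, fun h => ?_⟩
  · rw [← not_le, h.valuation_le_one_iff, not_le]
    exact one_lt_valuation_X
  · let v := P.valuationRing.valuation.comap (algebraMap (RatFunc K) F)
    have hv : v.IsTrivialOn K := ⟨fun a ha => by
      change P.valuationRing.valuation (algebraMap (RatFunc K) F (algebraMap K (RatFunc K) a)) = 1
      rw [← IsScalarTower.algebraMap_apply]
      exact P.valuation_algebraMap ha⟩
    ext z
    rw [ValuationSubring.mem_comap, ← ValuationSubring.valuation_le_one_iff]
    exact Valuation.isEquiv_iff_val_le_one.1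
      (RatFunc.valuation_isEquiv_inftyValuation_of_one_lt_valuation_X (v := v) h)

theorem le_e {P : (placeAtInfinity K).Over F} [FiniteDimensional (RatFunc K) F]
    [Algebra.IsSeparable (RatFunc K) F] {u : F} {k : ℕ} (hu : 1 < P.1.valuationRing.valuation u)
    (ht : P.1.valuationRing.valuation (algebraMap (RatFunc K) F RatFunc.X) =
      P.1.valuationRing.valuation u ^ k) : k ≤ P.e := by
  refine Place.Over.le_e P (u := u⁻¹) ?_ fun z hz => ?_
  · rw [map_inv₀]
    exact inv_lt_one_of_one_lt₀ hu
  · have h := (P.2.valuation_le_one_iff _).2 (valuation_mul_X_le_one hz)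
    rw [map_mul, map_mul, ht] at h
    rw [map_inv₀, inv_pow, ← one_div]
    exact (le_div_iff₀ (pow_pos (zero_lt_one.trans hu) k)).2 h

theorem two_le_f {P : (placeAtInfinity K).Over F} [FiniteDimensional (RatFunc K) F]
    [Algebra.IsSeparable (RatFunc K) F] [IsScalarTower K (RatFunc K) F] {w : F}
    (hw : P.1.valuationRing.valuation w ≤ 1) (hwK : ∀ c : K, ¬ P.1.HasValue w c) : 2 ≤ P.f := by
  refine Place.Over.two_le_f P hw fun z hz => ?_
  by_contra! hwz
  obtain ⟨c, hc⟩ := exists_hasValue hz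
  refine hwK c ?_
  rw [Place.HasValue, ← sub_add_sub_cancel w (algebraMap _ _ z)]
  exact Valuation.map_add_lt _ hwz (P.2.hasValue_algebraMap_iff.2 hc)

end placeAtInfinity

section Curve

variable {K F : Type*} [Field K] [Field F] [Algebra K F]

/-- The value of the curve polynomial at `T = x` is `t ^ (r + 1) * (x * (x - 1))` plus the value at
`x` of this polynomial with constant coefficients, where `r = 2 * e + 3`. -/
noncomputable def curveNumerator (K : Type*) [Field K] (e : ℕ) : K[X] :=
  X ^ (2 * e + 4) + 2 * X ^ (e + 2) - X ^ 3 + X ^ 2 + 1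

theorem eval_curveNumerator_zero (e : ℕ) : (curveNumerator K e).eval 0 = 1 := by
  simp [curveNumerator]

theorem eval_curveNumerator_one (e : ℕ) : (curveNumerator K e).eval 1 = 2 * 2 := by
  simp only [curveNumerator, eval_add, eval_sub, eval_mul, eval_pow, eval_X, eval_one, eval_ofNat]
  norm_num

/-- The polynomial giving the square of `curveFun` in terms of `x⁻¹`. -/
noncomputable def curveFunSq (K : Type*) [Field K] (e : ℕ) : K[X] :=
  -(1 + 2 * X ^ (e + 2) - X ^ (2 * e + 1) + X ^ (2 * e + 2) + X ^ (2 * e + 4)) * (1 - X)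

/-- The function `t ^ ((r + 1) / 2) * (x - 1) / x ^ ((r + 1) / 2)` for `r = 2 * e + 3`, whose values
at the poles of `x` are the square roots of `-1`. -/
def curveFun (x t : F) (e : ℕ) : F := t ^ (e + 2) * (x - 1) / x ^ (e + 2)

theorem eval_curveFunSq_zero (e : ℕ) : (curveFunSq K e).eval 0 = -1 := by
  simp [curveFunSq]

theorem eval_curveFunSq_one (e : ℕ) : (curveFunSq K e).eval 1 = 0 := by
  simp [curveFunSq]

theorem eval_derivative_curveFunSq_one (e : ℕ) : (derivative (curveFunSq K e)).eval 1 = 2 * 2 := by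
  rw [curveFunSq, derivative_mul]
  simp only [eval_add, eval_sub, eval_mul, eval_neg, eval_pow, eval_X, eval_one, eval_ofNat,
    derivative_sub, derivative_one, derivative_X]
  norm_num

theorem not_isSquare_curveFunSq (h2 : (2 : K) ≠ 0) (e : ℕ) : ¬ IsSquare (curveFunSq K e) := by
  rintro ⟨q, hq⟩
  have hq1 : q.eval 1 = 0 := by
    simpa [hq] using eval_curveFunSq_one (K := K) e
  have h := eval_derivative_curveFunSq_one (K := K) e
  rw [hq, derivative_mul, eval_add, eval_mul, eval_mul, hq1, mul_zero, zero_mul, add_zero] at h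
  exact mul_ne_zero h2 h2 h.symm

/-- The pair `(x, t)` satisfies the equation of the curve, with the powers of `t` moved to the left
and with `r = 2 * e + 3`. -/
def IsCurvePoint (K : Type*) {F : Type*} [Field K] [Field F] [Algebra K F] (x t : F) (e : ℕ) :
    Prop :=
  t ^ (2 * e + 4) * (x * (x - 1)) = -aeval x (curveNumerator K e)

namespace IsCurvePoint

variable {x t : F} {e : ℕ} {c : K} {P : Place K F}

theorem ne_zero (h : IsCurvePoint K x t e) : x ≠ 0 := by
  rintro rfl
  simp [IsCurvePoint, curveNumerator] at h

theorem sub_one_ne_zero (h : IsCurvePoint K x t e) (h2 : (2 : K) ≠ 0) : x - 1 ≠ 0 := by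
  intro hx
  have h1 : aeval (algebraMap K F 1) (curveNumerator K e) = 0 := by
    rw [map_one, ← sub_eq_zero.1 hx, ← neg_eq_zero, ← h, hx, mul_zero, mul_zero]
  rw [aeval_algebraMap_apply, coe_aeval_eq_eval, map_eq_zero, eval_curveNumerator_one] at h1
  exact mul_ne_zero h2 h2 h1

theorem transcendental (h : IsCurvePoint K x t e) (h2 : (2 : K) ≠ 0) (ht : Transcendental K t) :
    Transcendental K x := by
  intro hx
  have hxx : IsAlgebraic K (x * (x - 1)) := hx.mul (hx.sub isAlgebraic_one)
  have hN : IsAlgebraic K (aeval x (curveNumerator K e)) :=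
    not_not.1 fun hN => (transcendental_aeval_iff.1 hN).1 hx
  refine ht (IsAlgebraic.of_pow (n := 2 * e + 4) (by positivity) ?_)
  rw [eq_div_of_mul_eq (mul_ne_zero h.ne_zero (h.sub_one_ne_zero h2)) h]
  rw [div_eq_mul_inv]
  exact hN.neg.mul hxx.inv

theorem one_lt_valuation (h : IsCurvePoint K x t e) (hx : P.HasValue x c) (hc : c * (c - 1) = 0)
    (hN : (curveNumerator K e).eval c ≠ 0) : 1 < P.valuationRing.valuation t := by
  by_contra! ht
  have h0 : P.valuationRing.valuation (x * (x - 1)) < 1 := by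
    have := hx.aeval (X * (X - 1))
    rwa [eval_mul, eval_sub, eval_one, eval_X, hc, Place.hasValue_zero, map_mul, map_sub, aeval_X,
      map_one] at this
  have h1 : P.valuationRing.valuation (-aeval x (curveNumerator K e)) = 1 := by
    rw [Valuation.map_neg, (hx.aeval _).valuation_eq_one hN]
  rw [← h, map_mul, map_pow, mul_comm] at h1
  exact (mul_lt_one_of_lt_of_le h0 (pow_le_one₀ zero_le ht)).ne h1

theorem curveFun_sq (h : IsCurvePoint K x t e) (h2 : (2 : K) ≠ 0) :
    curveFun x t e ^ 2 = aeval x⁻¹ (curveFunSq K e) := by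
  have hx := h.ne_zero
  have hx1 := h.sub_one_ne_zero h2
  have sq_eq : curveFun x t e ^ 2 = t ^ (2 * e + 4) * (x - 1) ^ 2 / x ^ (2 * e + 4) := by
    rw [curveFun]
    ring
  rw [sq_eq, eq_div_of_mul_eq (mul_ne_zero hx hx1) h]
  simp only [curveFunSq, curveNumerator, map_mul, map_neg, map_sub, map_add, map_pow, map_one,
    aeval_X, map_ofNat, inv_pow]
  field_simp
  ring

section Pole

variable (hP : P.HasValue x⁻¹ 0)
include hP

theorem one_lt_valuation_x (h : IsCurvePoint K x t e) : 1 < P.valuationRing.valuation x :=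
  (Valuation.one_lt_val_iff _ h.ne_zero).2 (Place.hasValue_zero.1 hP)

theorem hasValue_curveFun_sq (h : IsCurvePoint K x t e) (h2 : (2 : K) ≠ 0) :
    P.HasValue (curveFun x t e ^ 2) (-1) := by
  rw [h.curveFun_sq h2, ← eval_curveFunSq_zero (K := K) e]
  exact hP.aeval _

theorem valuation_curveFun (h : IsCurvePoint K x t e) (h2 : (2 : K) ≠ 0) :
    P.valuationRing.valuation (curveFun x t e) = 1 := by
  have hsq := (h.hasValue_curveFun_sq hP h2).valuation_eq_one (neg_ne_zero.2 one_ne_zero)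
  rw [map_pow] at hsq
  exact (pow_eq_one_iff_of_nonneg zero_le two_ne_zero).1 hsq

theorem sq_eq_of_hasValue_curveFun (h : IsCurvePoint K x t e) (h2 : (2 : K) ≠ 0)
    (hc : P.HasValue (curveFun x t e) c) : c ^ 2 = -1 := by
  have hc2 := hc.aeval (X ^ 2)
  rw [map_pow, aeval_X, eval_pow, eval_X] at hc2
  exact hc2.eq (h.hasValue_curveFun_sq hP h2)

theorem valuation_div_pow (h : IsCurvePoint K x t e) (h2 : (2 : K) ≠ 0) (ht : t ≠ 0) :
    P.valuationRing.valuation (x / t) ^ (e + 2) = P.valuationRing.valuation x := by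
  have pow_mul_curveFun : (x / t) ^ (e + 2) * curveFun x t e = x - 1 := by
    have := h.ne_zero
    rw [curveFun, div_pow]
    field_simp
  have valuation_sub_one :
      P.valuationRing.valuation (x - 1) = P.valuationRing.valuation x :=
    Valuation.map_sub_eq_of_lt_left _ (by simpa only [map_one] using h.one_lt_valuation_x hP)
  rw [← valuation_sub_one, ← pow_mul_curveFun, map_mul, map_pow, h.valuation_curveFun hP h2,
    mul_one]

theorem one_lt_valuation_div (h : IsCurvePoint K x t e) (h2 : (2 : K) ≠ 0) (ht : t ≠ 0) :
    1 < P.valuationRing.valuation (x / t) := by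
  rw [← one_lt_pow_iff_of_nonneg zero_le (show e + 2 ≠ 0 by omega), h.valuation_div_pow hP h2 ht]
  exact h.one_lt_valuation_x hP

theorem valuation_eq_div_pow (h : IsCurvePoint K x t e) (h2 : (2 : K) ≠ 0) (ht : t ≠ 0) :
    P.valuationRing.valuation t = P.valuationRing.valuation (x / t) ^ (e + 1) := by
  have hpow := h.valuation_div_pow hP h2 ht
  nth_rw 2 [← div_mul_cancel₀ x ht] at hpow
  rw [map_mul, pow_succ',
    mul_right_inj' (zero_lt_one.trans (h.one_lt_valuation_div hP h2 ht)).ne'] at hpow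
  exact hpow.symm

end Pole

end IsCurvePoint

end Curve

section Simple

variable {E F : Type*} [Field E] [Field F] [Algebra E F] {x : F}

theorem isSeparable_of_aeval_derivative_ne_zero {p : E[X]} (hp : aeval x p = 0)
    (hp' : aeval x (derivative p) ≠ 0) : IsSeparable E x := by
  have hx : IsIntegral E x := IsAlgebraic.isIntegral ⟨p, by rintro rfl; simp at hp', hp⟩
  refine (separable_iff_derivative_ne_zero (minpoly.irreducible hx)).2 fun hm => hp' ?_
  obtain ⟨q, hq⟩ := minpoly.dvd E x hp
  rw [hq, derivative_mul, hm, zero_mul, zero_add, map_mul, minpoly.aeval, zero_mul]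

variable (hF : IntermediateField.adjoin E {x} = ⊤)
include hF

theorem finiteDimensional_of_adjoin_eq_top (hx : IsIntegral E x) : FiniteDimensional E F := by
  have := IntermediateField.adjoin.finiteDimensional hx
  rw [hF] at this
  exact IntermediateField.topEquiv.toLinearEquiv.finiteDimensional

theorem finrank_le_natDegree_of_adjoin_eq_top {p : E[X]} (hp : p.Monic) (hx : aeval x p = 0) :
    Module.finrank E F ≤ p.natDegree := by
  rw [← IntermediateField.finrank_top', ← hF, IntermediateField.adjoin.finrank ⟨p, hp, hx⟩]
  exact natDegree_le_of_dvd (minpoly.dvd E x hx) hp.ne_zero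

theorem algebra_isSeparable_of_adjoin_eq_top (hx : IsSeparable E x) : Algebra.IsSeparable E F := by
  have := IntermediateField.isSeparable_adjoin_simple_iff_isSeparable E F |>.2 hx
  rw [hF] at this
  exact AlgEquiv.Algebra.isSeparable IntermediateField.topEquiv

end Simple

namespace curvePoly

variable {K F : Type*} [Field K] [Field F] [Algebra K F] [Algebra (RatFunc K) F]
  [IsScalarTower K (RatFunc K) F] {x : F} {e : ℕ}

theorem eq_map_curveNumerator_add (K : Type*) [Field K] (e : ℕ) :
    curvePoly K (2 * e + 3) = (curveNumerator K e).map (algebraMap K (RatFunc K)) +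
      C (RatFunc.X ^ (2 * e + 4)) * (X * (X - 1)) := by
  rw [curvePoly, curveNumerator, show (2 * e + 3 + 1) / 2 = e + 2 by omega]
  simp only [Polynomial.map_add, Polynomial.map_sub, Polynomial.map_mul, Polynomial.map_pow,
    Polynomial.map_one, Polynomial.map_ofNat, map_X, C_add, C_1]
  ring

theorem natDegree_sub_X_pow_lt (K : Type*) [Field K] (e : ℕ) :
    (curvePoly K (2 * e + 3) - X ^ (2 * e + 4)).natDegree < 2 * e + 4 := by
  have heq : curvePoly K (2 * e + 3) - X ^ (2 * e + 4) =
      2 * X ^ (e + 2) - X ^ 3 + X ^ 2 * C (RatFunc.X ^ (2 * e + 4) + 1) -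
        X * C (RatFunc.X ^ (2 * e + 4)) + 1 := by
    rw [curvePoly, show (2 * e + 3 + 1) / 2 = e + 2 by omega]
    ring
  rw [heq, Nat.lt_succ_iff]
  compute_degree
  all_goals omega

theorem monic (K : Type*) [Field K] (e : ℕ) : (curvePoly K (2 * e + 3)).Monic := by
  rw [← add_sub_cancel (X ^ (2 * e + 4)) (curvePoly K (2 * e + 3))]
  refine monic_X_pow_add ?_
  rw [← degree_X_pow (R := RatFunc K)]
  exact degree_lt_degree ((natDegree_sub_X_pow_lt K e).trans_eq (natDegree_X_pow _).symm)

theorem natDegree_eq (K : Type*) [Field K] (e : ℕ) :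
    (curvePoly K (2 * e + 3)).natDegree = 2 * e + 4 := by
  rw [← add_sub_cancel (X ^ (2 * e + 4)) (curvePoly K (2 * e + 3)),
    natDegree_add_eq_left_of_natDegree_lt] <;> rw [natDegree_X_pow]
  exact natDegree_sub_X_pow_lt K e

theorem aeval_eq_zero_iff :
    aeval x (curvePoly K (2 * e + 3)) = 0 ↔
      IsCurvePoint K x (algebraMap (RatFunc K) F RatFunc.X) e := by
  rw [eq_map_curveNumerator_add, IsCurvePoint, ← add_eq_zero_iff_eq_neg, add_comm]
  simp only [map_add, map_mul, map_sub, map_one, aeval_X, aeval_C, map_pow, aeval_map_algebraMap]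

end curvePoly

namespace IsCurvePoint

variable {K F : Type*} [Field K] [Field F] [Algebra (RatFunc K) F]

theorem algebraMap_X_ne_zero : algebraMap (RatFunc K) F RatFunc.X ≠ 0 :=
  (_root_.map_ne_zero _).2 RatFunc.X_ne_zero

variable [Algebra K F] [IsScalarTower K (RatFunc K) F] {x : F} {e : ℕ}
  (h : IsCurvePoint K x (algebraMap (RatFunc K) F RatFunc.X) e) (h2 : (2 : K) ≠ 0)
include h h2

theorem transcendental_of_algebraMap_X : Transcendental K x :=
  h.transcendental h2 <|
    (transcendental_algebraMap_iff (algebraMap (RatFunc K) F).injective).2 RatFunc.transcendental_X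

theorem aeval_derivative_ne_zero : aeval x (derivative (curvePoly K (2 * e + 3))) ≠ 0 := by
  intro h0
  obtain ⟨P, hP⟩ :=
    Place.exists_hasValue_of_transcendental (h.transcendental_of_algebraMap_X h2) 0
  have ht := h.one_lt_valuation hP (zero_mul _) (by simp [eval_curveNumerator_zero])
  have valuation_eq_one : P.valuationRing.valuation (aeval x (2 * X - 1 : K[X])) = 1 :=
    (hP.aeval _).valuation_eq_one (by simp)
  have heq : aeval x (derivative (curveNumerator K e)) =
      -(algebraMap (RatFunc K) F RatFunc.X ^ (2 * e + 4) * aeval x (2 * X - 1 : K[X])) := by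
    rw [curvePoly.eq_map_curveNumerator_add, derivative_add, derivative_map, derivative_C_mul,
      map_add, aeval_map_algebraMap, ← eq_neg_iff_add_eq_zero] at h0
    rw [h0]
    simp only [derivative_mul, derivative_X, derivative_one, map_mul, map_add,
      map_sub, aeval_X, aeval_C, map_pow, map_one, map_zero, map_ofNat]
    ring
  have hle := Place.valuation_aeval_le_one hP.mem (derivative (curveNumerator K e))
  rw [heq, Valuation.map_neg, map_mul, map_pow, valuation_eq_one, mul_one] at hle
  exact (one_lt_pow₀ ht (by omega)).not_ge hle

theorem exists_over_hasValue {c : K} (hc : c * (c - 1) = 0) (hN : (curveNumerator K e).eval c ≠ 0) :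
    ∃ P : (placeAtInfinity K).Over F, P.1.HasValue x c := by
  obtain ⟨P, hP⟩ :=
    Place.exists_hasValue_of_transcendental (h.transcendental_of_algebraMap_X h2) c
  exact ⟨⟨P, (placeAtInfinity.liesOver_iff P).2 (h.one_lt_valuation hP hc hN)⟩, hP⟩

theorem exists_over_zero : ∃ P : (placeAtInfinity K).Over F, P.1.HasValue x 0 :=
  h.exists_over_hasValue h2 (zero_mul _) (eval_curveNumerator_zero (K := K) e ▸ one_ne_zero)

theorem exists_over_one : ∃ P : (placeAtInfinity K).Over F, P.1.HasValue x 1 :=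
  h.exists_over_hasValue h2 (by rw [sub_self, mul_zero])
    (eval_curveNumerator_one (K := K) e ▸ mul_ne_zero h2 h2)

omit [IsScalarTower K (RatFunc K) F] in
theorem one_lt_valuation_of_pole {P : Place K F} (hP : P.HasValue x⁻¹ 0) :
    1 < P.valuationRing.valuation (algebraMap (RatFunc K) F RatFunc.X) := by
  rw [h.valuation_eq_div_pow hP h2 algebraMap_X_ne_zero]
  exact one_lt_pow₀ (h.one_lt_valuation_div hP h2 algebraMap_X_ne_zero) e.succ_ne_zero

theorem transcendental_inv : Transcendental K x⁻¹ := fun hx =>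
  h.transcendental_of_algebraMap_X h2 (inv_inv x ▸ hx.inv)

theorem exists_over_pole : ∃ P : (placeAtInfinity K).Over F, P.1.HasValue x⁻¹ 0 := by
  obtain ⟨P, hP⟩ := Place.exists_hasValue_of_transcendental (h.transcendental_inv h2) 0
  exact ⟨⟨P, (placeAtInfinity.liesOver_iff P).2 (h.one_lt_valuation_of_pole h2 hP)⟩, hP⟩

theorem exists_over_pole_of_sq_eq_neg_one {i : K} (hi : i ^ 2 = -1) :
    ∃ P : (placeAtInfinity K).Over F, P.1.HasValue x⁻¹ 0 ∧
      P.1.HasValue (curveFun x (algebraMap (RatFunc K) F RatFunc.X) e) i := by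
  obtain ⟨P, hP, hPi⟩ := Place.exists_hasValue_of_sq_eq_aeval (h.transcendental_inv h2)
    (not_isSquare_curveFunSq h2 e) (h.curveFun_sq h2) (hi.trans (eval_curveFunSq_zero e).symm)
  exact ⟨⟨P, (placeAtInfinity.liesOver_iff P).2 (h.one_lt_valuation_of_pole h2 hP)⟩, hP, hPi⟩

variable [FiniteDimensional (RatFunc K) F] [Algebra.IsSeparable (RatFunc K) F]
  {P : (placeAtInfinity K).Over F} (hP : P.1.HasValue x⁻¹ 0)
include hP

omit [IsScalarTower K (RatFunc K) F] in
theorem le_e_of_pole : e + 1 ≤ P.e :=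
  placeAtInfinity.le_e (h.one_lt_valuation_div hP h2 algebraMap_X_ne_zero)
    (h.valuation_eq_div_pow hP h2 algebraMap_X_ne_zero)

theorem two_le_f_of_pole (hi : ¬ IsSquare (-1 : K)) : 2 ≤ P.f :=
  placeAtInfinity.two_le_f (h.valuation_curveFun hP h2).le fun c hc =>
    hi ⟨c, by rw [← sq, h.sq_eq_of_hasValue_curveFun hP h2 hc]⟩

end IsCurvePoint

namespace IsCurvePoint

variable {K F : Type*} [Field K] [Field F] [Algebra K F] [Algebra (RatFunc K) F]
  [IsScalarTower K (RatFunc K) F] [FiniteDimensional (RatFunc K) F]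
  [Algebra.IsSeparable (RatFunc K) F] {x : F} {e : ℕ}
  (h : IsCurvePoint K x (algebraMap (RatFunc K) F RatFunc.X) e) (h2 : (2 : K) ≠ 0)
  (hfinrank : Module.finrank (RatFunc K) F ≤ 2 * e + 4)
include h h2 hfinrank

theorem exists_four_over_infinity {i : K} (hi : i ^ 2 = -1) :
    ∃ P₁ P₂ P₃ P₄ : (placeAtInfinity K).Over F,
      [P₁, P₂, P₃, P₄].Nodup ∧
      (∀ P : (placeAtInfinity K).Over F, P = P₁ ∨ P = P₂ ∨ P = P₃ ∨ P = P₄) ∧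
      (P₁.e = 1 ∧ P₁.f = 1) ∧ (P₂.e = 1 ∧ P₂.f = 1) ∧
      (P₃.e = e + 1 ∧ P₃.f = 1) ∧ (P₄.e = e + 1 ∧ P₄.f = 1) := by
  obtain ⟨P₁, hP₁⟩ := h.exists_over_zero h2
  obtain ⟨P₂, hP₂⟩ := h.exists_over_one h2
  obtain ⟨P₃, hP₃, hP₃i⟩ := h.exists_over_pole_of_sq_eq_neg_one h2 hi
  obtain ⟨P₄, hP₄, hP₄i⟩ := h.exists_over_pole_of_sq_eq_neg_one h2 ((neg_sq i).trans hi)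
  have ne_neg : i ≠ -i := by
    rw [Ne, ← add_eq_zero_iff_eq_neg, ← two_mul]
    refine mul_ne_zero h2 fun hi0 => ?_
    simp [hi0] at hi
  have nodup : [P₁, P₂, P₃, P₄].Nodup := by
    refine .of_map (fun P => P.1) ?_
    simp [hP₁.ne hP₂ zero_ne_one, hP₁.ne_of_inv hP₃ h.ne_zero, hP₁.ne_of_inv hP₄ h.ne_zero,
      hP₂.ne_of_inv hP₃ h.ne_zero, hP₂.ne_of_inv hP₄ h.ne_zero, hP₃i.ne hP₄i ne_neg]
  obtain ⟨surj, e_and_f⟩ := Place.Over.surjective_and_eq_of_finrank_le_sum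
    (P := ![P₁, P₂, P₃, P₄]) (ε := ![1, 1, e + 1, e + 1]) (φ := ![1, 1, 1, 1])
    (List.nodup_ofFn.1 (by simpa using nodup))
    (by simp [Fin.forall_fin_succ, Nat.one_le_iff_ne_zero, P₁.e_pos.ne', P₂.e_pos.ne',
      h.le_e_of_pole h2 hP₃, h.le_e_of_pole h2 hP₄])
    (by simp [Fin.forall_fin_succ, Nat.one_le_iff_ne_zero, P₁.f_pos.ne', P₂.f_pos.ne',
      P₃.f_pos.ne', P₄.f_pos.ne'])
    (hfinrank.trans_eq (by simp only [Fin.sum_univ_four, Matrix.cons_val]; ring))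
  refine ⟨P₁, P₂, P₃, P₄, nodup, fun P => ?_, e_and_f 0, e_and_f 1, e_and_f 2, e_and_f 3⟩
  obtain ⟨j, rfl⟩ := surj P
  fin_cases j <;> simp

theorem exists_three_over_infinity (hsq : ¬ IsSquare (-1 : K)) :
    ∃ P₁ P₂ P₃ : (placeAtInfinity K).Over F,
      [P₁, P₂, P₃].Nodup ∧
      (∀ P : (placeAtInfinity K).Over F, P = P₁ ∨ P = P₂ ∨ P = P₃) ∧
      (P₁.e = 1 ∧ P₁.f = 1) ∧ (P₂.e = 1 ∧ P₂.f = 1) ∧ (P₃.e = e + 1 ∧ P₃.f = 2) := by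
  obtain ⟨P₁, hP₁⟩ := h.exists_over_zero h2
  obtain ⟨P₂, hP₂⟩ := h.exists_over_one h2
  obtain ⟨P₃, hP₃⟩ := h.exists_over_pole h2
  have nodup : [P₁, P₂, P₃].Nodup := by
    refine .of_map (fun P => P.1) ?_
    simp [hP₁.ne hP₂ zero_ne_one, hP₁.ne_of_inv hP₃ h.ne_zero, hP₂.ne_of_inv hP₃ h.ne_zero]
  obtain ⟨surj, e_and_f⟩ := Place.Over.surjective_and_eq_of_finrank_le_sum
    (P := ![P₁, P₂, P₃]) (ε := ![1, 1, e + 1]) (φ := ![1, 1, 2])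
    (List.nodup_ofFn.1 (by simpa using nodup))
    (by simp [Fin.forall_fin_succ, Nat.one_le_iff_ne_zero, P₁.e_pos.ne', P₂.e_pos.ne',
      h.le_e_of_pole h2 hP₃])
    (by simp [Fin.forall_fin_succ, Nat.one_le_iff_ne_zero, P₁.f_pos.ne', P₂.f_pos.ne',
      h.two_le_f_of_pole h2 hP₃ hsq])
    (hfinrank.trans_eq (by simp only [Fin.sum_univ_three, Matrix.cons_val]; ring))
  refine ⟨P₁, P₂, P₃, nodup, fun P => ?_, e_and_f 0, e_and_f 1, e_and_f 2⟩
  obtain ⟨j, rfl⟩ := surj P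
  fin_cases j <;> simp

end IsCurvePoint

theorem two_ne_zero_of_card {K : Type*} [Field K] [Finite K] {r q m : ℕ} (hodd : Odd r)
    (hqr : q ≡ 1 [MOD r + 1]) (hK : Nat.card K = q ^ m) : (2 : K) ≠ 0 := by
  intro h2
  have hq : Odd q := Nat.odd_iff.2 (hqr.of_dvd hodd.add_one.two_dvd)
  have : CharP K 2 := CharTwo.of_one_ne_zero_of_two_eq_zero one_ne_zero h2
  have : Fintype K := Fintype.ofFinite K
  obtain ⟨n, -, hn⟩ := FiniteField.card K 2
  rw [← Nat.card_eq_fintype_card, hK] at hn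
  exact Nat.not_even_iff_odd.2 hq.pow (hn ▸ even_two.pow_of_ne_zero n.ne_zero)

theorem mainTheorem6_general (r : ℕ) (hr : 3 ≤ r) (hodd : Odd r)
    (K : Type*) [Field K] (h2 : (2 : K) ≠ 0)
    (F : Type*) [Field F] [Algebra K F] [Algebra (RatFunc K) F] [IsScalarTower K (RatFunc K) F]
    (x : F) (hx : Polynomial.aeval x (curvePoly K r) = 0)
    (hF : IntermediateField.adjoin (RatFunc K) {x} = ⊤) :
    (IsSquare (-1 : K) →
      ∃ P₁ P₂ P₃ P₄ : (placeAtInfinity K).Over F,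
        [P₁, P₂, P₃, P₄].Nodup ∧
        (∀ P : (placeAtInfinity K).Over F, P = P₁ ∨ P = P₂ ∨ P = P₃ ∨ P = P₄) ∧
        (P₁.e = 1 ∧ P₁.f = 1) ∧
        (P₂.e = 1 ∧ P₂.f = 1) ∧
        (P₃.e = (r - 1) / 2 ∧ P₃.f = 1) ∧
        (P₄.e = (r - 1) / 2 ∧ P₄.f = 1)) ∧
    (¬ IsSquare (-1 : K) →
      ∃ P₁ P₂ P₃ : (placeAtInfinity K).Over F,
        [P₁, P₂, P₃].Nodup ∧
        (∀ P : (placeAtInfinity K).Over F, P = P₁ ∨ P = P₂ ∨ P = P₃) ∧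
        (P₁.e = 1 ∧ P₁.f = 1) ∧
        (P₂.e = 1 ∧ P₂.f = 1) ∧
        (P₃.e = (r - 1) / 2 ∧ P₃.f = 2)) := by
  obtain ⟨e, rfl⟩ : ∃ e, r = 2 * e + 3 := by
    obtain ⟨k, rfl⟩ := hodd
    exact ⟨k - 1, by omega⟩
  have h := curvePoly.aeval_eq_zero_iff.1 hx
  have := finiteDimensional_of_adjoin_eq_top hF ⟨_, curvePoly.monic K e, hx⟩
  have := algebra_isSeparable_of_adjoin_eq_top hF
    (isSeparable_of_aeval_derivative_ne_zero hx (h.aeval_derivative_ne_zero h2))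
  have hfinrank : Module.finrank (RatFunc K) F ≤ 2 * e + 4 :=
    curvePoly.natDegree_eq K e ▸
      finrank_le_natDegree_of_adjoin_eq_top hF (curvePoly.monic K e) hx
  rw [show (2 * e + 3 - 1) / 2 = e + 1 by omega]
  refine ⟨fun ⟨i, hi⟩ => ?_, h.exists_three_over_infinity h2 hfinrank⟩
  exact h.exists_four_over_infinity h2 hfinrank ((sq i).trans hi.symm)

theorem mainTheorem6 (r q m : ℕ) (hr : 3 ≤ r) (hodd : Odd r) (hq : IsPrimePow q)
    (hqr : q ≡ 1 [MOD r + 1]) (hm : 1 ≤ m)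
    (K : Type*) [Field K] [Finite K] (hK : Nat.card K = q ^ m)
    (F : Type*) [Field F] [Algebra K F] [Algebra (RatFunc K) F] [IsScalarTower K (RatFunc K) F]
    (x : F) (hx : Polynomial.aeval x (curvePoly K r) = 0)
    (hF : IntermediateField.adjoin (RatFunc K) {x} = ⊤) :
    (IsSquare (-1 : K) →
      ∃ P₁ P₂ P₃ P₄ : (placeAtInfinity K).Over F,
        [P₁, P₂, P₃, P₄].Nodup ∧
        (∀ P : (placeAtInfinity K).Over F, P = P₁ ∨ P = P₂ ∨ P = P₃ ∨ P = P₄) ∧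
        (P₁.e = 1 ∧ P₁.f = 1) ∧
        (P₂.e = 1 ∧ P₂.f = 1) ∧
        (P₃.e = (r - 1) / 2 ∧ P₃.f = 1) ∧
        (P₄.e = (r - 1) / 2 ∧ P₄.f = 1)) ∧
    (¬ IsSquare (-1 : K) →
      ∃ P₁ P₂ P₃ : (placeAtInfinity K).Over F,
        [P₁, P₂, P₃].Nodup ∧
        (∀ P : (placeAtInfinity K).Over F, P = P₁ ∨ P = P₂ ∨ P = P₃) ∧
        (P₁.e = 1 ∧ P₁.f = 1) ∧
        (P₂.e = 1 ∧ P₂.f = 1) ∧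
        (P₃.e = (r - 1) / 2 ∧ P₃.f = 2)) :=
  mainTheorem6_general r hr hodd K (two_ne_zero_of_card hodd hqr hK) F x hx hF
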